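/- Let $P_{3,n}$ be the space of real homogeneous polynomials of degree $3$ in $n$ variables. For $p=\sum_{|\alpha|=3}c_\alpha x^\alpha\in P_{3,n}$ let \[ \|p\|_\infty=\max_{x\in\mathbb{R}^n,\ \|x\|=1}|p(x)|,\qquad \|p\|_B=\Bigl(\sum_{|\alpha|=3}\binom{3}{\alpha}^{-1}|c_\alpha|^2\Bigr)^{1/2},\qquad \binom{3}{\alpha}=\frac{3!}{\alpha_1!\cdots\alpha_n!}, \] where $\|x\|$ is the Euclidean norm, be the uniform norm on the unit sphere and the Bombieri norm, and let \[ T_{3,n}(x)=x_1^3-3x_1(x_2^2+\dots+x_n^2) \] be the cubic Chebyshev form. (1) For every $n\ge 2$, $T_{3,n}$ is a local minimum of the ratio $\|p\|_\infty/\|p\|_B$ on the nonzero forms in $P_{3,n}$: there is $\varepsilon>0$ (depending on $n$) such that every nonzero $p\in P_{3,n}$ with $\|p-T_{3,n}\|_B<\varepsilon$ satisfies \[ \frac{\|p\|_\infty}{\|p\|_B}\ \ge\ \frac{\|T_{3,n}\|_\infty}{\|T_{3,n}\|_B}. \] (2) For all sufficiently large $n$, $T_{3,n}$ is not a global minimizer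 of this ratio: there is $N$ such that for every $n\ge N$ some nonzero $p\in P_{3,n}$ satisfies \[ \frac{\|p\|_\infty}{\|p\|_B}\ <\ \frac{\|T_{3,n}\|_\infty}{\|T_{3,n}\|_B}. \] -/

import Mathlib

noncomputable section

namespace ChebyshevForm

/-- The unit sphere `‖x‖ = 1` of Euclidean space `ℝⁿ`. -/
def unitSphere (n : ℕ) : Set (EuclideanSpace ℝ (Fin n)) := Metric.sphere 0 1

/-- The uniform norm `‖p‖_∞ = max_{‖x‖ = 1} |p(x)|` on the Euclidean unit sphere; the supremum is
a maximum for `n ≥ 1`, see `uniformNorm_isGreatest`. -/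
def uniformNorm {n : ℕ} (p : MvPolynomial (Fin n) ℝ) : ℝ :=
  sSup ((fun x : EuclideanSpace ℝ (Fin n) => |MvPolynomial.eval (fun i => x i) p|) '' unitSphere n)

/-- The Bombieri norm `‖p‖_B = √(∑_α (d choose α)⁻¹ |c_α|²)` of a form `p = ∑_{|α| = d} c_α x^α`.
Here `α.multinomial = |α|! / (α₁! ⋯ αₙ!)`, and `|α| = d` for every monomial of a form of
degree `d`. -/
def bombieriNorm {n : ℕ} (p : MvPolynomial (Fin n) ℝ) : ℝ :=
  Real.sqrt (∑ α ∈ p.support, (α.multinomial : ℝ)⁻¹ * |p.coeff α| ^ 2)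

/-- The space `P_{d,n}` of real forms of degree `d` in `n` variables. -/
abbrev forms (d n : ℕ) : Submodule ℝ (MvPolynomial (Fin n) ℝ) :=
  MvPolynomial.homogeneousSubmodule (Fin n) ℝ d

/-- The ratio `‖p‖_∞ / ‖p‖_B`. -/
def normRatio {n : ℕ} (p : MvPolynomial (Fin n) ℝ) : ℝ := uniformNorm p / bombieriNorm p

/-- The cubic Chebyshev form `x₁³ - 3 x₁ (x₂² + ⋯ + xₙ²)`; the variable `x₁` has index `0`. -/
def chebyshevCubic (n : ℕ) [NeZero n] : MvPolynomial (Fin n) ℝ :=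
  MvPolynomial.X 0 ^ 3 -
    3 * MvPolynomial.X 0 * ∑ i ∈ Finset.univ.erase (0 : Fin n), MvPolynomial.X i ^ 2

theorem chebyshevCubic_mem (n : ℕ) [NeZero n] : chebyshevCubic n ∈ forms 3 n := by
  rw [MvPolynomial.mem_homogeneousSubmodule]
  refine MvPolynomial.IsHomogeneous.sub (MvPolynomial.isHomogeneous_X_pow _ _) ?_
  have h3 : (3 : MvPolynomial (Fin n) ℝ).IsHomogeneous 0 := by
    rw [← map_ofNat (MvPolynomial.C : ℝ →+* MvPolynomial (Fin n) ℝ) 3]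
    exact MvPolynomial.isHomogeneous_C _ _
  have hs : (∑ i ∈ Finset.univ.erase (0 : Fin n),
      (MvPolynomial.X i : MvPolynomial (Fin n) ℝ) ^ 2).IsHomogeneous 2 :=
    MvPolynomial.IsHomogeneous.sum _ _ _ fun i _ => MvPolynomial.isHomogeneous_X_pow i 2
  exact (h3.mul (MvPolynomial.isHomogeneous_X ℝ 0)).mul hs

theorem uniformNorm_isGreatest {n : ℕ} [NeZero n] (p : MvPolynomial (Fin n) ℝ) :
    IsGreatest ((fun x : EuclideanSpace ℝ (Fin n) =>
      |MvPolynomial.eval (fun i => x i) p|) '' unitSphere n) (uniformNorm p) := by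
  have hc : Continuous (fun x : EuclideanSpace ℝ (Fin n) =>
      |MvPolynomial.eval (fun i => x i) p|) :=
    ((MvPolynomial.continuous_eval p).comp (by fun_prop)).abs
  have hne : (unitSphere n).Nonempty :=
    ⟨EuclideanSpace.single 0 1, by simp [unitSphere]⟩
  exact ((isCompact_sphere _ _).image hc).isGreatest_sSup (hne.image _)

end ChebyshevForm

end

/-! Identify a cubic form with its symmetric 3-tensor `a`; the Bombieri norm becomes the
Hilbert–Schmidt norm, which is rotation invariant. Let `T_f` be the Chebyshev tensor with unit axis
`f`. On the sphere its cubic is `4t³ - 3t` with `t = ⟪f, x⟫`, so it has maximum 1, attained at `f`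
and wherever `t = -1/2`; its squared norm is `W = 3n - 2`.

Local minimality: write `M` for the maximum of the cubic of `a` on the sphere; the claim is `‖a‖² ≤
W M²`. Choose the axis `f` maximizing the inner product of `a` with `T_f`, and let `s T_f` be the
projection of `a` onto the line through `T_f`. The remainder `q = a - s T_f` is orthogonal to `T_f`
and, by maximality, to infinitesimal rotations of the axis. Where `T_f` equals 1, `q` is at most `D
= M - s`. These one-sided bounds and the two orthogonality relations control all of `q`: `‖q‖ ≤ C D`
(`IsExtremalRemainder.tensorNormSq_le`). If `a` is `ε`-close to a Chebyshev tensor then also `‖q‖ ≤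
ε`, so `‖q‖² ≤ C ε D`. This is linear in `D` with a small constant, hence absorbed by the cross term
`2 W s D` of `W M² = W (s + D)²`, while `‖a‖² = W s² + ‖q‖²` (`tensorNormSq_le_of_close`).

Failure of global minimality: `∑ⱼ Re((u + iv)(yⱼ + izⱼ)²)` with `m` blocks has squared uniform norm
at most `4/27` and squared Bombieri norm at least `4m/3`, about `2n/3`. The Chebyshev ratio would
require at most `(3n - 2) · 4/27`, about `4n/9`. -/

namespace ChebyshevForm

open Finset MvPolynomial

/-! ### Cubic forms as symmetric tensors. -/

/-- The exponent of the monomial `x_i x_j x_k`. -/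
noncomputable def tripleExponent {n : ℕ} (t : Fin n × Fin n × Fin n) : Fin n →₀ ℕ :=
  Finsupp.single t.1 1 + Finsupp.single t.2.1 1 + Finsupp.single t.2.2 1

/-- Both sides are the coefficient of `x^α` in `(∑ xᵢ)³` over `ℕ`, computed by expanding the product
and by the multinomial theorem. -/
theorem card_tripleExponent_eq {n : ℕ} {α : Fin n →₀ ℕ} (hα : α.sum (fun _ m => m) = 3) :
    #{t : Fin n × Fin n × Fin n | tripleExponent t = α} = α.multinomial := by
  have h := coeff_linearCombination_X_pow_of_fintype (R := ℕ) (fun _ : Fin n => 1) α 3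
  simp only [one_smul, hα, if_true, one_pow, Finsupp.prod, Finset.prod_const_one, mul_one] at h
  rw [Nat.cast_id] at h
  rw [← h, pow_succ, pow_two, Finset.sum_mul_sum, ← Finset.sum_product', Finset.sum_mul_sum,
    ← Finset.sum_product', coeff_sum, Finset.card_filter]
  refine Finset.sum_equiv (Equiv.prodAssoc _ _ _).symm (by simp) fun t _ => ?_
  have : (X t.1 * X t.2.1 * X t.2.2 : MvPolynomial (Fin n) ℕ) = monomial (tripleExponent t) 1 := by
    simp [X, tripleExponent, monomial_mul]
  simp [this, coeff_monomial]

theorem tripleExponent_mem {n : ℕ} (t : Fin n × Fin n × Fin n) :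
    tripleExponent t ∈ finsuppAntidiag (univ : Finset (Fin n)) 3 := by
  simp [tripleExponent, Finset.sum_add_distrib]

theorem sum_tripleExponent {n : ℕ} (φ : (Fin n →₀ ℕ) → ℝ) :
    ∑ t, φ (tripleExponent t) =
      ∑ α ∈ finsuppAntidiag (univ : Finset (Fin n)) 3, (α.multinomial : ℝ) * φ α := by
  rw [← Finset.sum_fiberwise_of_maps_to (g := tripleExponent)
    (t := finsuppAntidiag (univ : Finset (Fin n)) 3) (fun t _ => tripleExponent_mem t)]
  refine Finset.sum_congr rfl fun α hα => ?_
  rw [Finset.sum_congr rfl (g := fun _ => φ α), Finset.sum_const, card_tripleExponent_eq,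
    nsmul_eq_mul]
  · exact (mem_finsuppAntidiag'.1 hα).1
  · intro t ht
    rw [(Finset.mem_filter.1 ht).2]

theorem support_subset_of_mem_forms {n : ℕ} {p : MvPolynomial (Fin n) ℝ} (hp : p ∈ forms 3 n) :
    p.support ⊆ finsuppAntidiag (univ : Finset (Fin n)) 3 := by
  intro α hα
  rw [mem_homogeneousSubmodule] at hp
  have := hp (mem_support_iff.1 hα)
  change Finsupp.weight (fun _ => 1) α = 3 at this
  rw [← Finsupp.degree_eq_weight_one, Finsupp.degree_apply] at this
  exact mem_finsuppAntidiag'.2 ⟨this, Finset.subset_univ _⟩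

/-- The entries of the symmetric tensor of a cubic form. -/
noncomputable def tensorEntry {n : ℕ} (p : MvPolynomial (Fin n) ℝ) (i j k : Fin n) : ℝ :=
  p.coeff (tripleExponent (i, j, k)) / (tripleExponent (i, j, k)).multinomial

theorem multinomial_ne_zero {n : ℕ} (α : Fin n →₀ ℕ) : (α.multinomial : ℝ) ≠ 0 := by
  rw [Finsupp.multinomial_eq]
  exact_mod_cast (Nat.multinomial_pos _ _).ne'

theorem sum_univ_triple {n : ℕ} (f : Fin n → Fin n → Fin n → ℝ) :
    ∑ i, ∑ j, ∑ k, f i j k = ∑ t : Fin n × Fin n × Fin n, f t.1 t.2.1 t.2.2 := by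
  simp only [Fintype.sum_prod_type]

/-- Each monomial `α` accounts for `α.multinomial` equal tensor entries `c_α / α.multinomial`, which
leaves exactly the Bombieri weight. -/
theorem sum_tensorEntry_sq {n : ℕ} {p : MvPolynomial (Fin n) ℝ} (hp : p ∈ forms 3 n) :
    ∑ i, ∑ j, ∑ k, tensorEntry p i j k ^ 2 = bombieriNorm p ^ 2 := by
  rw [bombieriNorm, Real.sq_sqrt (by positivity),
    Finset.sum_subset (support_subset_of_mem_forms hp) (by
      intro α _ h
      simp [notMem_support_iff.1 h]), sum_univ_triple,
    ← (sum_tripleExponent fun α => (p.coeff α / α.multinomial) ^ 2).trans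
      (Finset.sum_congr rfl fun α _ => ?_)]
  · rfl
  · have := multinomial_ne_zero α
    rw [sq_abs]
    field_simp

theorem sum_tensorEntry_mul {n : ℕ} {p : MvPolynomial (Fin n) ℝ} (hp : p ∈ forms 3 n)
    (x : Fin n → ℝ) :
    ∑ i, ∑ j, ∑ k, tensorEntry p i j k * (x i * x j * x k) = eval x p := by
  rw [eval_eq', Finset.sum_subset (support_subset_of_mem_forms hp) (by
      intro α _ h
      simp [notMem_support_iff.1 h]), sum_univ_triple,
    ← (sum_tripleExponent fun α => p.coeff α / α.multinomial * ∏ i, x i ^ α i).trans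
      (Finset.sum_congr rfl fun α _ => ?_)]
  · refine Finset.sum_congr rfl fun t _ => ?_
    have h (a : Fin n) : ∏ i, x i ^ (Finsupp.single a 1 : Fin n →₀ ℕ) i = x a := by
      rw [Finset.prod_eq_single a (fun b _ hb => by simp [hb.symm])
        (by simp)]
      simp
    simp only [tensorEntry, tripleExponent, Finsupp.add_apply, pow_add, Finset.prod_mul_distrib, h]
  · have := multinomial_ne_zero α
    field_simp

theorem tensorEntry_comm12 {n : ℕ} (p : MvPolynomial (Fin n) ℝ) (i j k : Fin n) :
    tensorEntry p i j k = tensorEntry p j i k := by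
  have : tripleExponent (i, j, k) = tripleExponent (j, i, k) := by
    simp only [tripleExponent]; abel
  simp only [tensorEntry, this]

theorem tensorEntry_comm23 {n : ℕ} (p : MvPolynomial (Fin n) ℝ) (i j k : Fin n) :
    tensorEntry p i j k = tensorEntry p i k j := by
  have : tripleExponent (i, j, k) = tripleExponent (i, k, j) := by
    simp only [tripleExponent]; abel
  simp only [tensorEntry, this]

theorem tensorEntry_sub {n : ℕ} (p q : MvPolynomial (Fin n) ℝ) (i j k : Fin n) :
    tensorEntry (p - q) i j k = tensorEntry p i j k - tensorEntry q i j k := by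
  simp only [tensorEntry, coeff_sub, sub_div]

open scoped RealInnerProductSpace

/-! ### Symmetric trilinear forms and the rotation-invariant norm. -/

section Trilinear

variable {E : Type*} [NormedAddCommGroup E] [InnerProductSpace ℝ E]

/-- Symmetric trilinear forms. -/
structure IsSymTrilinear (a : E → E → E → ℝ) : Prop where
  add_left : ∀ x x' y z, a (x + x') y z = a x y z + a x' y z
  smul_left : ∀ (c : ℝ) x y z, a (c • x) y z = c * a x y z
  comm12 : ∀ x y z, a x y z = a y x z
  comm23 : ∀ x y z, a x y z = a x z y

namespace IsSymTrilinear

variable {a a' : E → E → E → ℝ}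

theorem add_mid (h : IsSymTrilinear a) (x y y' z : E) :
    a x (y + y') z = a x y z + a x y' z := by
  rw [h.comm12, h.add_left, h.comm12 y, h.comm12 y']

theorem add_right (h : IsSymTrilinear a) (x y z z' : E) :
    a x y (z + z') = a x y z + a x y z' := by
  rw [h.comm23, h.add_mid, h.comm23 x z, h.comm23 x z']

theorem smul_mid (h : IsSymTrilinear a) (c : ℝ) (x y z : E) : a x (c • y) z = c * a x y z := by
  rw [h.comm12, h.smul_left, h.comm12 y]

theorem smul_right (h : IsSymTrilinear a) (c : ℝ) (x y z : E) : a x y (c • z) = c * a x y z := by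
  rw [h.comm23, h.smul_mid, h.comm23 x z]

theorem neg_left (h : IsSymTrilinear a) (x y z : E) : a (-x) y z = -a x y z := by
  simpa using h.smul_left (-1) x y z

theorem neg_mid (h : IsSymTrilinear a) (x y z : E) : a x (-y) z = -a x y z := by
  simpa using h.smul_mid (-1) x y z

theorem neg_right (h : IsSymTrilinear a) (x y z : E) : a x y (-z) = -a x y z := by
  simpa using h.smul_right (-1) x y z

theorem isLinearMap_left (h : IsSymTrilinear a) (y z : E) : IsLinearMap ℝ fun x => a x y z :=
  ⟨fun x x' => h.add_left x x' y z, fun c x => h.smul_left c x y z⟩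

theorem isLinearMap_mid (h : IsSymTrilinear a) (x z : E) : IsLinearMap ℝ fun y => a x y z :=
  ⟨fun y y' => h.add_mid x y y' z, fun c y => h.smul_mid c x y z⟩

theorem isLinearMap_right (h : IsSymTrilinear a) (x y : E) : IsLinearMap ℝ fun z => a x y z :=
  ⟨fun z z' => h.add_right x y z z', fun c z => h.smul_right c x y z⟩

theorem sub_smul (h : IsSymTrilinear a) (h' : IsSymTrilinear a') (s : ℝ) :
    IsSymTrilinear fun x y z => a x y z - s * a' x y z where
  add_left x x' y z := by rw [h.add_left, h'.add_left]; ring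
  smul_left c x y z := by rw [h.smul_left, h'.smul_left]; ring
  comm12 x y z := by rw [h.comm12, h'.comm12]
  comm23 x y z := by rw [h.comm23, h'.comm23]

theorem diag_combination (h : IsSymTrilinear a) (α β : ℝ) (f u : E) :
    a (α • f + β • u) (α • f + β • u) (α • f + β • u) =
      α ^ 3 * a f f f + 3 * α ^ 2 * β * a f f u + 3 * α * β ^ 2 * a f u u + β ^ 3 * a u u u := by
  simp only [h.add_left, h.add_mid, h.add_right, h.smul_left, h.smul_mid, h.smul_right]
  rw [h.comm12 u f f, h.comm23 f u f, h.comm12 u f u, h.comm23 u u f, h.comm12 u f u]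
  ring

theorem polarization (h : IsSymTrilinear a) (x y z : E) :
    24 * a x y z = a (x + y + z) (x + y + z) (x + y + z)
      - a (x + y + -z) (x + y + -z) (x + y + -z) - a (x + -y + z) (x + -y + z) (x + -y + z)
      + a (x + -y + -z) (x + -y + -z) (x + -y + -z) := by
  simp only [h.add_left, h.add_mid, h.add_right, h.neg_left, h.neg_mid, h.neg_right]
  rw [h.comm23 x z y, h.comm12 y x z, h.comm23 y z x, h.comm12 y x z, h.comm12 z x y,
    h.comm23 x z y, h.comm23 z y x, h.comm12 z x y, h.comm23 x z y]
  ring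

theorem eq_of_diag_eq (h : IsSymTrilinear a) (h' : IsSymTrilinear a')
    (hd : ∀ x, a x x x = a' x x x) (x y z : E) : a x y z = a' x y z := by
  have := h.polarization x y z
  have := h'.polarization x y z
  simp only [hd] at *
  linarith

end IsSymTrilinear

variable {ι : Type*} [Fintype ι]

theorem sum_inner_mul_map {φ : E → ℝ} (hφ : IsLinearMap ℝ φ) (b : OrthonormalBasis ι ℝ E) (x : E) :
    ∑ i, ⟪x, b i⟫ * φ (b i) = φ x := by
  have h : (hφ.mk' φ) (∑ i, ⟪b i, x⟫ • b i) = φ x := by rw [b.sum_repr']; rfl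
  rw [map_sum] at h
  simpa [real_inner_comm] using h

/-- The trace of a bilinear form does not depend on the basis: expand one slot in `c`, exchange the
sums, contract the other slot in `b`. -/
theorem sum_bilinear_diag_eq {β : E → E → ℝ} (h₁ : ∀ y, IsLinearMap ℝ fun x => β x y)
    (h₂ : ∀ x, IsLinearMap ℝ (β x)) (b c : OrthonormalBasis ι ℝ E) :
    ∑ i, β (b i) (b i) = ∑ i, β (c i) (c i) := by
  calc ∑ i, β (b i) (b i) = ∑ i, ∑ j, ⟪c j, b i⟫ * β (c j) (b i) := by
        refine Finset.sum_congr rfl fun i _ => ?_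
        rw [← sum_inner_mul_map (h₁ (b i)) c (b i)]
        exact Finset.sum_congr rfl fun j _ => by rw [real_inner_comm]
    _ = ∑ j, ∑ i, ⟪c j, b i⟫ * β (c j) (b i) := Finset.sum_comm
    _ = ∑ j, β (c j) (c j) :=
        Finset.sum_congr rfl fun j _ => sum_inner_mul_map (h₂ (c j)) b (c j)

/-- The squared Hilbert–Schmidt norm of a trilinear form in an orthonormal basis. -/
noncomputable def tensorNormSq (b : OrthonormalBasis ι ℝ E) (a : E → E → E → ℝ) : ℝ :=
  ∑ i, ∑ j, ∑ k, a (b i) (b j) (b k) ^ 2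

theorem isLinearMap_sum_mul {κ : Type*} [Fintype κ] {g : κ → E → ℝ}
    (hg : ∀ k, IsLinearMap ℝ (g k)) (c : κ → ℝ) : IsLinearMap ℝ fun x => ∑ k, g k x * c k :=
  ⟨fun x y => by simp only [(hg _).map_add, add_mul, Finset.sum_add_distrib],
   fun r x => by simp only [(hg _).map_smul, smul_eq_mul, Finset.mul_sum, mul_assoc]⟩

theorem isLinearMap_sum_mul' {κ : Type*} [Fintype κ] {g : κ → E → ℝ}
    (hg : ∀ k, IsLinearMap ℝ (g k)) (c : κ → ℝ) : IsLinearMap ℝ fun x => ∑ k, c k * g k x := by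
  simpa only [mul_comm] using isLinearMap_sum_mul hg c

theorem sum_mul_self_eq {κ : Type*} [Fintype κ] {g : κ → E → ℝ}
    (hg : ∀ k, IsLinearMap ℝ (g k)) (b c : OrthonormalBasis ι ℝ E) :
    ∑ i, ∑ k, g k (b i) ^ 2 = ∑ i, ∑ k, g k (c i) ^ 2 := by
  simp only [sq]
  exact sum_bilinear_diag_eq (β := fun x y => ∑ k, g k x * g k y)
    (fun y => isLinearMap_sum_mul hg _) (fun x => isLinearMap_sum_mul' hg _) b c

/-- The basis is changed one slot at a time; for each slot the sum of squares is a trace. -/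
theorem tensorNormSq_eq {a : E → E → E → ℝ} (h : IsSymTrilinear a) (b c : OrthonormalBasis ι ℝ E) :
    tensorNormSq b a = tensorNormSq c a := by
  have h₁ : tensorNormSq b a = ∑ i, ∑ j, ∑ k, a (c i) (b j) (b k) ^ 2 := by
    have := sum_mul_self_eq (κ := ι × ι) (g := fun t x => a x (b t.1) (b t.2))
      (fun t => h.isLinearMap_left _ _) b c
    simpa only [Fintype.sum_prod_type, tensorNormSq] using this
  have h₂ (x : E) : ∑ j, ∑ k, a x (b j) (b k) ^ 2 = ∑ j, ∑ k, a x (c j) (c k) ^ 2 := by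
    rw [sum_mul_self_eq (g := fun k y => a x y (b k)) (fun k => h.isLinearMap_mid _ _) b c]
    refine Finset.sum_congr rfl fun j _ => ?_
    have := sum_mul_self_eq (κ := Unit) (g := fun _ z => a x (c j) z)
      (fun k => h.isLinearMap_right _ _) b c
    simpa using this
  rw [h₁]
  simp only [h₂, tensorNormSq]

/-! ### The Chebyshev tensor and projection onto it. -/

/-- The symmetric trilinear form of the cubic Chebyshev form with axis `f`. -/
noncomputable def chebyshevTensor (f x y z : E) : ℝ :=
  4 * (⟪f, x⟫ * ⟪f, y⟫ * ⟪f, z⟫) - (⟪f, x⟫ * ⟪y, z⟫ + ⟪f, y⟫ * ⟪x, z⟫ + ⟪f, z⟫ * ⟪x, y⟫)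

theorem isSymTrilinear_chebyshevTensor (f : E) : IsSymTrilinear (chebyshevTensor f) where
  add_left x x' y z := by simp only [chebyshevTensor, inner_add_left, inner_add_right]; ring
  smul_left c x y z := by
    simp only [chebyshevTensor, real_inner_smul_left, real_inner_smul_right]; ring
  comm12 x y z := by simp only [chebyshevTensor, real_inner_comm x y]; ring
  comm23 x y z := by simp only [chebyshevTensor, real_inner_comm y z]; ring

/-- The Hilbert–Schmidt product of a symmetric trilinear form with `chebyshevTensor f`. -/
noncomputable def axisFunctional (b : OrthonormalBasis ι ℝ E) (a : E → E → E → ℝ) (f : E) : ℝ :=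
  4 * a f f f - 3 * ∑ i, a f (b i) (b i)

/-- Contraction with `⟪f, ·⟫` inserts `f` into a slot and contraction with the inner product takes a
trace; by symmetry the three trace terms coincide. -/
theorem sum_mul_chebyshevTensor {a : E → E → E → ℝ} (h : IsSymTrilinear a)
    (b : OrthonormalBasis ι ℝ E) (f : E) :
    ∑ i, ∑ j, ∑ k, a (b i) (b j) (b k) * chebyshevTensor f (b i) (b j) (b k) =
      axisFunctional b a f := by
  classical
  have e₁ : ∑ i, ∑ j, ∑ k, a (b i) (b j) (b k) * (⟪f, b i⟫ * ⟪f, b j⟫ * ⟪f, b k⟫) = a f f f := by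
    calc _ = ∑ i, ⟪f, b i⟫ * ∑ j, ⟪f, b j⟫ * ∑ k, ⟪f, b k⟫ * a (b i) (b j) (b k) := by
          simp only [Finset.mul_sum]
          refine Finset.sum_congr rfl fun i _ => Finset.sum_congr rfl fun j _ =>
            Finset.sum_congr rfl fun k _ => by ring
      _ = a f f f := by
          simp only [sum_inner_mul_map (h.isLinearMap_right _ _),
            sum_inner_mul_map (h.isLinearMap_mid _ _), sum_inner_mul_map (h.isLinearMap_left _ _)]
  have e₂ : ∑ i, ∑ j, ∑ k, a (b i) (b j) (b k) * (⟪f, b i⟫ * ⟪b j, b k⟫) =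
      ∑ i, a f (b i) (b i) := by
    simp only [b.inner_eq_ite, mul_ite, mul_one, mul_zero, Finset.sum_ite_eq, Finset.mem_univ,
      if_true]
    rw [Finset.sum_comm]
    refine Finset.sum_congr rfl fun j _ => ?_
    rw [← sum_inner_mul_map (h.isLinearMap_left (b j) (b j)) b f]
    exact Finset.sum_congr rfl fun i _ => mul_comm _ _
  have e₃ : ∑ i, ∑ j, ∑ k, a (b i) (b j) (b k) * (⟪f, b j⟫ * ⟪b i, b k⟫) =
      ∑ i, a f (b i) (b i) := by
    rw [Finset.sum_comm, ← e₂]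
    refine Finset.sum_congr rfl fun i _ => Finset.sum_congr rfl fun j _ =>
      Finset.sum_congr rfl fun k _ => by rw [h.comm12]
  have e₄ : ∑ i, ∑ j, ∑ k, a (b i) (b j) (b k) * (⟪f, b k⟫ * ⟪b i, b j⟫) =
      ∑ i, a f (b i) (b i) := by
    rw [← e₃]
    refine Finset.sum_congr rfl fun i _ => ?_
    rw [Finset.sum_comm]
    refine Finset.sum_congr rfl fun j _ => Finset.sum_congr rfl fun k _ => by rw [h.comm23]
  calc _ = 4 * ∑ i, ∑ j, ∑ k, a (b i) (b j) (b k) * (⟪f, b i⟫ * ⟪f, b j⟫ * ⟪f, b k⟫)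
        - (∑ i, ∑ j, ∑ k, a (b i) (b j) (b k) * (⟪f, b i⟫ * ⟪b j, b k⟫)
          + ∑ i, ∑ j, ∑ k, a (b i) (b j) (b k) * (⟪f, b j⟫ * ⟪b i, b k⟫)
          + ∑ i, ∑ j, ∑ k, a (b i) (b j) (b k) * (⟪f, b k⟫ * ⟪b i, b j⟫)) := by
        simp only [Finset.mul_sum, ← Finset.sum_add_distrib, ← Finset.sum_sub_distrib,
          chebyshevTensor]
        refine Finset.sum_congr rfl fun i _ => Finset.sum_congr rfl fun j _ =>
          Finset.sum_congr rfl fun k _ => by ring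
    _ = _ := by rw [e₁, e₂, e₃, e₄, axisFunctional]; ring

theorem sum_chebyshevTensor (b : OrthonormalBasis ι ℝ E) (f u : E) (hf : ‖f‖ = 1) :
    ∑ i, chebyshevTensor f u (b i) (b i) = (2 - Fintype.card ι) * ⟪f, u⟫ := by
  have h₁ : ∑ i, ⟪f, b i⟫ * ⟪f, b i⟫ = 1 := by
    have := b.sum_inner_mul_inner f f
    rw [real_inner_self_eq_norm_sq, hf] at this
    simpa [real_inner_comm] using this
  have h₂ : ∑ i, ⟪f, b i⟫ * ⟪u, b i⟫ = ⟪f, u⟫ := by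
    have := b.sum_inner_mul_inner f u
    simpa [real_inner_comm] using this
  calc _ = 4 * ⟪f, u⟫ * ∑ i, ⟪f, b i⟫ * ⟪f, b i⟫ - ∑ _i : ι, ⟪f, u⟫
        - 2 * ∑ i, ⟪f, b i⟫ * ⟪u, b i⟫ := by
        simp only [Finset.mul_sum, ← Finset.sum_sub_distrib, chebyshevTensor]
        refine Finset.sum_congr rfl fun i _ => ?_
        rw [real_inner_self_eq_norm_sq, b.norm_eq_one]
        ring
    _ = _ := by rw [h₁, h₂]; simp; ring

theorem axisFunctional_chebyshevTensor (b : OrthonormalBasis ι ℝ E) (f : E) (hf : ‖f‖ = 1) :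
    axisFunctional b (chebyshevTensor f) f = 3 * Fintype.card ι - 2 := by
  rw [axisFunctional, sum_chebyshevTensor b f f hf, chebyshevTensor, real_inner_self_eq_norm_sq, hf]
  ring

theorem tensorNormSq_sub_chebyshevTensor {a : E → E → E → ℝ} (h : IsSymTrilinear a)
    (b : OrthonormalBasis ι ℝ E) (f : E) (hf : ‖f‖ = 1) (s : ℝ) :
    tensorNormSq b (fun x y z => a x y z - s * chebyshevTensor f x y z) =
      tensorNormSq b a - 2 * s * axisFunctional b a f + s ^ 2 * (3 * Fintype.card ι - 2) := by
  rw [← axisFunctional_chebyshevTensor b f hf, ← sum_mul_chebyshevTensor h,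
    ← sum_mul_chebyshevTensor (isSymTrilinear_chebyshevTensor f)]
  simp only [tensorNormSq, Finset.mul_sum, ← Finset.sum_add_distrib, ← Finset.sum_sub_distrib]
  refine Finset.sum_congr rfl fun i _ => Finset.sum_congr rfl fun j _ =>
    Finset.sum_congr rfl fun k _ => by ring

end Trilinear

/-! ### One-sided bounds on the contact set control the whole remainder. -/

section Entries

variable {E : Type*} [NormedAddCommGroup E] [InnerProductSpace ℝ E]

/-- Trilinear forms at most `D` at the points where the Chebyshev form with axis `f` is maximal,
and satisfying the first-order conditions for the axis. -/
structure IsExtremalRemainder {ι : Type*} [Fintype ι] (q : E → E → E → ℝ)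
    (b : OrthonormalBasis ι ℝ E) (f : E) (D : ℝ) : Prop where
  symm : IsSymTrilinear q
  axis : 4 * q f f f = 3 * ∑ i, q f (b i) (b i)
  perp : ∀ u, ⟪f, u⟫ = 0 → 4 * q f f u = ∑ i, q u (b i) (b i)
  le_axis : q f f f ≤ D
  le_circle : ∀ u, ‖u‖ = 1 → ⟪f, u⟫ = 0 → ∀ y, y = (-(1 / 2) : ℝ) • f + (√3 / 2) • u → q y y y ≤ D

namespace IsExtremalRemainder

section Basic

variable {ι : Type*} [Fintype ι] {q : E → E → E → ℝ} {b : OrthonormalBasis ι ℝ E} {f : E} {D : ℝ}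

/-- Expand `q` at the contact points with directions `u` and `-u`: the terms odd in `u` change sign,
so both inequalities together bound their absolute value. -/
theorem circle_bound (h : IsExtremalRemainder q b f D) {u : E} (hu : ‖u‖ = 1) (hfu : ⟪f, u⟫ = 0) :
    3 / 4 * (√3 / 2) * |q f f u + q u u u| ≤ D + q f f f / 8 + 9 / 8 * q f u u := by
  have e₁ := h.le_circle u hu hfu _ rfl
  have e₂ := h.le_circle (-u) (by simpa using hu) (by simpa using hfu) _ rfl
  rw [h.symm.diag_combination] at e₁ e₂
  simp only [h.symm.neg_left, h.symm.neg_mid, h.symm.neg_right] at e₂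
  have h3 : (√3 / 2) ^ 2 = 3 / 4 := by rw [div_pow, Real.sq_sqrt (by norm_num)]; norm_num
  have h4 : (√3 / 2) ^ 3 = 3 / 4 * (√3 / 2) := by rw [pow_succ, h3]
  rw [h3, h4] at e₁ e₂
  rw [mul_assoc]
  have hs : 0 ≤ √3 / 2 := by positivity
  rcases abs_cases (q f f u + q u u u) with ⟨h, _⟩ | ⟨h, _⟩ <;> rw [h] <;> linarith

theorem neg_le (h : IsExtremalRemainder q b f D) {u : E} (hu : ‖u‖ = 1) (hfu : ⟪f, u⟫ = 0) :
    -D ≤ q f u u := by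
  have e := h.circle_bound hu hfu
  have := h.le_axis
  have : 0 ≤ 3 / 4 * (√3 / 2) * |q f f u + q u u u| := by positivity
  linarith

/-- The slice of `q` along the axis, shifted to be positive semidefinite. -/
noncomputable def slice (q : E → E → E → ℝ) (f : E) (D : ℝ) (x y : E) : ℝ := q f x y + D * ⟪x, y⟫

theorem slice_nonneg (h : IsExtremalRemainder q b f D) {w : E} (hw : ⟪f, w⟫ = 0) :
    0 ≤ slice q f D w w := by
  rcases eq_or_ne w 0 with rfl | h0
  · simpa [slice] using (h.symm.smul_mid 0 f 0 0).symm.le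
  · have hn : ‖w‖ ≠ 0 := norm_ne_zero_iff.2 h0
    have e := h.neg_le (u := ‖w‖⁻¹ • w) (by rw [norm_smul]; simp [hn])
      (by rw [real_inner_smul_right, hw, mul_zero])
    rw [h.symm.smul_mid, h.symm.smul_right] at e
    have : -D * ‖w‖ ^ 2 ≤ q f w w := by
      calc -D * ‖w‖ ^ 2 ≤ (‖w‖⁻¹ * (‖w‖⁻¹ * q f w w)) * ‖w‖ ^ 2 := by gcongr
        _ = q f w w := by field_simp
    rw [slice, real_inner_self_eq_norm_sq]
    linarith

/-- Parallelogram law together with nonnegativity of the slice at `x - y`. -/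
theorem slice_add_le (h : IsExtremalRemainder q b f D) {x y : E} (hx : ⟪f, x⟫ = 0)
    (hy : ⟪f, y⟫ = 0) :
    slice q f D (x + y) (x + y) ≤ 2 * slice q f D x x + 2 * slice q f D y y := by
  have e := h.slice_nonneg (w := x + -y) (by rw [inner_add_right, inner_neg_right, hx, hy]; simp)
  simp only [slice, h.symm.add_mid, h.symm.add_right, h.symm.neg_mid, h.symm.neg_right,
    inner_add_left, inner_add_right, inner_neg_left, inner_neg_right] at e ⊢
  linarith

theorem abs_slice_le (h : IsExtremalRemainder q b f D) {x y : E} {R : ℝ} (hx : ⟪f, x⟫ = 0)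
    (hy : ⟪f, y⟫ = 0) (hxR : slice q f D x x ≤ R) (hyR : slice q f D y y ≤ R) :
    |slice q f D x y| ≤ R := by
  have e := h.slice_nonneg (w := x + -y) (by rw [inner_add_right, inner_neg_right, hx, hy]; simp)
  have e' := h.slice_nonneg (w := x + y) (by rw [inner_add_right, hx, hy]; simp)
  simp only [slice, h.symm.add_mid, h.symm.add_right, h.symm.neg_mid, h.symm.neg_right,
    inner_add_left, inner_add_right, inner_neg_left, inner_neg_right] at e e' hxR hyR ⊢
  rw [h.symm.comm23 f y x, real_inner_comm x y] at e e'
  rw [abs_le]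
  constructor <;> linarith

/-- The trilinear form of the cubic `w ↦ q(w, w, w) + q(f, f, w) ‖w‖²`. -/
noncomputable def corrected (q : E → E → E → ℝ) (f x y z : E) : ℝ :=
  q x y z + (q f f x * ⟪y, z⟫ + q f f y * ⟪x, z⟫ + q f f z * ⟪x, y⟫) / 3

theorem isSymTrilinear_corrected (h : IsSymTrilinear q) : IsSymTrilinear (corrected q f) where
  add_left x x' y z := by
    simp only [corrected, h.add_left, h.add_right, inner_add_left]; ring
  smul_left c x y z := by
    simp only [corrected, h.smul_left, h.smul_right, real_inner_smul_left]; ring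
  comm12 x y z := by simp only [corrected, real_inner_comm x y, h.comm12 x y]; ring
  comm23 x y z := by simp only [corrected, real_inner_comm y z, h.comm23 x y]; ring

/-- The bound on the circle, made homogeneous of degree 3 in `w`. It only sees `q(f, f, w)` and
`q(w, w, w)` combined, which is why the corrected cubic is estimated first. -/
theorem corrected_diag_bound (h : IsExtremalRemainder q b f D) {w : E} (hw : ⟪f, w⟫ = 0) :
    3 / 4 * (√3 / 2) * |corrected q f w w w| ≤
      (D + q f f f / 8) * ‖w‖ ^ 3 + 9 / 8 * ‖w‖ * q f w w := by
  have hG : corrected q f w w w = q f f w * ‖w‖ ^ 2 + q w w w := by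
    rw [corrected, real_inner_self_eq_norm_sq]; ring
  rcases eq_or_ne w 0 with rfl | h0
  · have := h.symm.smul_left 0 0 0 0
    simp only [zero_smul, zero_mul] at this
    simp [hG, this]
  · have hn : ‖w‖ ≠ 0 := norm_ne_zero_iff.2 h0
    have hp : 0 < ‖w‖ := norm_pos_iff.2 h0
    have e := h.circle_bound (u := ‖w‖⁻¹ • w) (by rw [norm_smul]; simp [hn])
      (by rw [real_inner_smul_right, hw, mul_zero])
    simp only [h.symm.smul_left, h.symm.smul_mid, h.symm.smul_right] at e
    have e₁ : corrected q f w w w =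
        ‖w‖ ^ 3 * (‖w‖⁻¹ * q f f w + ‖w‖⁻¹ * (‖w‖⁻¹ * (‖w‖⁻¹ * q w w w))) := by
      rw [hG]; field_simp
    rw [e₁, abs_mul, abs_of_pos (pow_pos hp 3)]
    calc _ = ‖w‖ ^ 3 * (3 / 4 * (√3 / 2) *
          |‖w‖⁻¹ * q f f w + ‖w‖⁻¹ * (‖w‖⁻¹ * (‖w‖⁻¹ * q w w w))|) := by ring
      _ ≤ ‖w‖ ^ 3 * (D + q f f f / 8 + 9 / 8 * (‖w‖⁻¹ * (‖w‖⁻¹ * q f w w))) := by gcongr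
      _ = _ := by field_simp

theorem corrected_sum_bound (h : IsExtremalRemainder q b f D) (hD : 0 ≤ D) {N : ℝ} (hN : 1 ≤ N)
    {x y z : E} (hx : ⟪f, x⟫ = 0) (hy : ⟪f, y⟫ = 0) (hz : ⟪f, z⟫ = 0)
    (hx1 : ‖x‖ = 1) (hy1 : ‖y‖ = 1) (hz1 : ‖z‖ = 1) (hxN : slice q f D x x ≤ N * D)
    (hyN : slice q f D y y ≤ N * D) (hzN : slice q f D z z ≤ N * D) :
    |corrected q f (x + y + z) (x + y + z) (x + y + z)| ≤ 100 * (N * D) := by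
  have hw : ⟪f, x + y + z⟫ = 0 := by simp [inner_add_right, hx, hy, hz]
  have e := h.corrected_diag_bound hw
  have e₁ := h.slice_add_le (x := x + y) (y := z) (by simp [inner_add_right, hx, hy]) hz
  have e₂ := h.slice_add_le hx hy
  have hn : ‖x + y + z‖ ≤ 3 := by
    have := norm_add₃_le (a := x) (b := y) (c := z)
    linarith
  have hρ := norm_nonneg (x + y + z)
  have hND : D ≤ N * D := le_mul_of_one_le_left hD hN
  have hq : q f (x + y + z) (x + y + z) ≤ 10 * (N * D) := by
    have : slice q f D (x + y + z) (x + y + z) ≤ 10 * (N * D) := by linarith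
    have hpos : 0 ≤ D * ⟪x + y + z, x + y + z⟫ := mul_nonneg hD real_inner_self_nonneg
    rw [slice] at this
    linarith
  have b₁ : (D + q f f f / 8) * ‖x + y + z‖ ^ 3 ≤ 9 / 8 * (N * D) * 27 := by
    have h3 : ‖x + y + z‖ ^ 3 ≤ 27 := by
      calc _ ≤ (3 : ℝ) ^ 3 := by gcongr
        _ = 27 := by norm_num
    calc _ ≤ 9 / 8 * (N * D) * ‖x + y + z‖ ^ 3 := by
          gcongr
          linarith [h.le_axis]
      _ ≤ _ := by gcongr
  have b₂ : 9 / 8 * ‖x + y + z‖ * q f (x + y + z) (x + y + z) ≤ 9 / 8 * 3 * (10 * (N * D)) := by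
    calc _ ≤ 9 / 8 * ‖x + y + z‖ * (10 * (N * D)) := by gcongr
      _ ≤ _ := by gcongr
  -- The right-hand sides add up to `64.125 N D`; dividing by `3/4 · 1.72/2 = 0.645` gives less than
  -- `100 N D`.
  have hs : (1.72 : ℝ) ≤ √3 := Real.le_sqrt_of_sq_le (by norm_num)
  have hA := abs_nonneg (corrected q f (x + y + z) (x + y + z) (x + y + z))
  nlinarith [mul_le_mul_of_nonneg_right hs hA]

end Basic

section Bound

variable {m : ℕ} {q : E → E → E → ℝ} {b : OrthonormalBasis (Fin (m + 1)) ℝ E} {D : ℝ}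

theorem inner_zero_succ (b : OrthonormalBasis (Fin (m + 1)) ℝ E) (i : Fin m) :
    ⟪b 0, b i.succ⟫ = 0 := by
  rw [b.inner_eq_ite, if_neg (Fin.succ_ne_zero i).symm]

theorem axis_eq (h : IsExtremalRemainder q b (b 0) D) :
    q (b 0) (b 0) (b 0) = 3 * ∑ i : Fin m, q (b 0) (b i.succ) (b i.succ) := by
  have := h.axis
  rw [Fin.sum_univ_succ] at this
  linarith

/-- If `D < 0`, the slice of `q` along the axis is positive on the orthogonal complement, so
orthogonality to the Chebyshev tensor forces `q(f, f, f) ≥ 0 > D`. -/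
theorem nonneg (h : IsExtremalRemainder q b (b 0) D) : 0 ≤ D := by
  by_contra! hD
  have h₁ := h.axis_eq
  have h₂ : 0 ≤ ∑ i : Fin m, q (b 0) (b i.succ) (b i.succ) := Finset.sum_nonneg fun i _ => by
    have := h.neg_le (b.norm_eq_one i.succ) (inner_zero_succ b i)
    linarith
  have := h.le_axis
  linarith

/-- A diagonal entry of a positive semidefinite form is at most its trace, and the trace of the
slice is `q(f, f, f) / 3 + m D`. -/
theorem slice_le (h : IsExtremalRemainder q b (b 0) D) (i : Fin m) :
    slice q (b 0) D (b i.succ) (b i.succ) ≤ (m + 1) * D := by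
  have hs := Finset.single_le_sum (f := fun i : Fin m => slice q (b 0) D (b i.succ) (b i.succ))
    (fun j _ => h.slice_nonneg (inner_zero_succ b j)) (Finset.mem_univ i)
  refine hs.trans ?_
  simp only [slice, b.inner_eq_one, Finset.sum_add_distrib, Finset.sum_const, Finset.card_univ,
    Fintype.card_fin, nsmul_eq_mul, mul_one]
  have := h.axis_eq
  have := h.le_axis
  have := h.nonneg
  linarith

theorem abs_axis_le (h : IsExtremalRemainder q b (b 0) D) :
    |q (b 0) (b 0) (b 0)| ≤ 3 * ((m + 1) * D) := by
  have hD := h.nonneg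
  have h₁ := h.axis_eq
  have h₂ : ∑ _i : Fin m, (-D) ≤ ∑ i : Fin m, q (b 0) (b i.succ) (b i.succ) :=
    Finset.sum_le_sum fun i _ => h.neg_le (b.norm_eq_one i.succ) (inner_zero_succ b i)
  simp only [Finset.sum_const, Finset.card_univ, Fintype.card_fin, nsmul_eq_mul] at h₂
  have hm : 0 ≤ (m : ℝ) * D := by positivity
  have := h.le_axis
  rw [abs_le]
  constructor <;> linarith

theorem abs_axis_succ_succ_le (h : IsExtremalRemainder q b (b 0) D) (i j : Fin m) :
    |q (b 0) (b i.succ) (b j.succ)| ≤ (m + 1) * D := by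
  have hD := h.nonneg
  rcases eq_or_ne i j with rfl | hij
  · have h₁ := h.slice_le i
    have h₂ := h.neg_le (b.norm_eq_one i.succ) (inner_zero_succ b i)
    simp only [slice, b.inner_eq_one] at h₁
    have hm : 0 ≤ (m : ℝ) * D := by positivity
    rw [abs_le]
    constructor <;> linarith
  · have h₁ := h.abs_slice_le (inner_zero_succ b i) (inner_zero_succ b j) (h.slice_le i)
      (h.slice_le j)
    rwa [slice, b.inner_eq_ite, if_neg (by simpa using hij), mul_zero, add_zero] at h₁

/-- Polarization uses four diagonal values, each at most `100 (m + 1) D`, and `400 / 24 < 17`. -/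
theorem abs_corrected_le (h : IsExtremalRemainder q b (b 0) D) (i j k : Fin m) :
    |corrected q (b 0) (b i.succ) (b j.succ) (b k.succ)| ≤ 17 * ((m + 1) * D) := by
  have hneg (i : Fin m) : slice q (b 0) D (-b i.succ) (-b i.succ) ≤ (m + 1) * D := by
    simpa [slice, h.symm.neg_mid, h.symm.neg_right] using h.slice_le i
  have hneg' (i : Fin m) : ⟪b 0, -b i.succ⟫ = 0 := by
    rw [inner_neg_right, inner_zero_succ, neg_zero]
  have hnorm (i : Fin m) : ‖-b i.succ‖ = 1 := by rw [norm_neg, b.norm_eq_one]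
  have hD := h.nonneg
  have hN : (1 : ℝ) ≤ m + 1 := by simp
  have hm : 0 ≤ ((m : ℝ) + 1) * D := by positivity
  have hp := (isSymTrilinear_corrected (f := b 0) h.symm).polarization
    (b i.succ) (b j.succ) (b k.succ)
  have p := inner_zero_succ b
  have n := fun i : Fin m => b.norm_eq_one i.succ
  have s := h.slice_le
  have e₁ := abs_le.1 <|
    h.corrected_sum_bound hD hN (p i) (p j) (p k) (n i) (n j) (n k) (s i) (s j) (s k)
  have e₂ := abs_le.1 <| h.corrected_sum_bound hD hN (p i) (p j) (hneg' k) (n i) (n j) (hnorm k)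
    (s i) (s j) (hneg k)
  have e₃ := abs_le.1 <| h.corrected_sum_bound hD hN (p i) (hneg' j) (p k) (n i) (hnorm j) (n k)
    (s i) (hneg j) (s k)
  have e₄ := abs_le.1 <| h.corrected_sum_bound hD hN (p i) (hneg' j) (hneg' k) (n i) (hnorm j)
    (hnorm k) (s i) (hneg j) (hneg k)
  rw [abs_le]
  constructor <;> linarith

/-- The first-order condition on the axis separates the two parts of the corrected form: it gives
`∑ᵢ q(e_k, eᵢ, eᵢ) = 3 q(f, f, e_k)` over the complement of `f`. The trace of the corrected form is
therefore a positive multiple, at least 3, of `q(f, f, e_k)`. -/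
theorem abs_axis_axis_succ_le (h : IsExtremalRemainder q b (b 0) D) (k : Fin m) :
    |q (b 0) (b 0) (b k.succ)| ≤ 6 * ((m + 1) ^ 2 * D) := by
  have hD := h.nonneg
  have h₁ := h.perp (b k.succ) (inner_zero_succ b k)
  rw [Fin.sum_univ_succ, h.symm.comm12 (b k.succ), h.symm.comm23 _ (b k.succ)] at h₁
  have h₂ : ∑ i : Fin m, corrected q (b 0) (b k.succ) (b i.succ) (b i.succ) =
      (3 + m / 3 + 2 / 3) * q (b 0) (b 0) (b k.succ) := by
    simp only [corrected, b.inner_eq_one, b.inner_eq_ite, Finset.sum_add_distrib, ← Finset.sum_div,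
      Fin.succ_inj, mul_ite, mul_one, mul_zero, Finset.sum_ite_eq, Finset.mem_univ, if_true,
      Finset.sum_const, Finset.card_univ, Fintype.card_fin, nsmul_eq_mul]
    linarith
  have h₃ : |∑ i : Fin m, corrected q (b 0) (b k.succ) (b i.succ) (b i.succ)| ≤
      m * (17 * ((m + 1) * D)) := by
    refine (Finset.abs_sum_le_sum_abs _ _).trans
      ((Finset.sum_le_sum fun i _ => h.abs_corrected_le k i i).trans ?_)
    simp
  rw [h₂, abs_mul, abs_of_pos (by positivity)] at h₃
  have h₄ : 3 * |q (b 0) (b 0) (b k.succ)| ≤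
      (3 + m / 3 + 2 / 3) * |q (b 0) (b 0) (b k.succ)| := by
    gcongr
    have : (0 : ℝ) ≤ m := m.cast_nonneg
    linarith
  have : (m : ℝ) * (17 * ((m + 1) * D)) ≤ 18 * ((m + 1) ^ 2 * D) := by
    have : 0 ≤ (m : ℝ) * D := by positivity
    have : 0 ≤ (m : ℝ) ^ 2 * D := by positivity
    linarith
  linarith

theorem abs_succ_succ_succ_le (h : IsExtremalRemainder q b (b 0) D) (i j k : Fin m) :
    |q (b i.succ) (b j.succ) (b k.succ)| ≤ 23 * ((m + 1) ^ 2 * D) := by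
  have hD := h.nonneg
  have hG := h.abs_corrected_le i j k
  have hin (i j : Fin m) (c : ℝ) : |c * ⟪b i.succ, b j.succ⟫| ≤ |c| := by
    rw [b.inner_eq_ite]
    split_ifs <;> simp
  have a₁ := abs_le.1 ((hin j k _).trans (h.abs_axis_axis_succ_le i))
  have a₂ := abs_le.1 ((hin i k _).trans (h.abs_axis_axis_succ_le j))
  have a₃ := abs_le.1 ((hin i j _).trans (h.abs_axis_axis_succ_le k))
  have : ((m : ℝ) + 1) * D ≤ (m + 1) ^ 2 * D := by
    have : 0 ≤ (m : ℝ) * D := by positivity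
    have : 0 ≤ (m : ℝ) ^ 2 * D := by positivity
    linarith
  rw [corrected, abs_le] at hG
  rw [abs_le]
  constructor <;> linarith

theorem abs_le_of_basis (h : IsExtremalRemainder q b (b 0) D) (i j k : Fin (m + 1)) :
    |q (b i) (b j) (b k)| ≤ 23 * ((m + 1) ^ 2 * D) := by
  have hD := h.nonneg
  have hm : ((m : ℝ) + 1) * D ≤ (m + 1) ^ 2 * D := by
    have : 0 ≤ (m : ℝ) * D := by positivity
    have : 0 ≤ (m : ℝ) ^ 2 * D := by positivity
    linarith
  have hm' : 0 ≤ ((m : ℝ) + 1) * D := by positivity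
  have c₀ : |q (b 0) (b 0) (b 0)| ≤ 23 * ((m + 1) ^ 2 * D) := by linarith [h.abs_axis_le]
  have c₁ (k : Fin m) : |q (b 0) (b 0) (b k.succ)| ≤ 23 * ((m + 1) ^ 2 * D) := by
    linarith [h.abs_axis_axis_succ_le k]
  have c₂ (j k : Fin m) : |q (b 0) (b j.succ) (b k.succ)| ≤ 23 * ((m + 1) ^ 2 * D) := by
    linarith [h.abs_axis_succ_succ_le j k]
  refine Fin.cases ?_ (fun i => ?_) i <;> refine Fin.cases ?_ (fun j => ?_) j <;>
    refine Fin.cases ?_ (fun k => ?_) k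
  · exact c₀
  · exact c₁ k
  · rw [h.symm.comm23]; exact c₁ j
  · exact c₂ j k
  · rw [h.symm.comm12, h.symm.comm23]; exact c₁ i
  · rw [h.symm.comm12]; exact c₂ i k
  · rw [h.symm.comm23, h.symm.comm12]; exact c₂ i j
  · exact h.abs_succ_succ_succ_le i j k

theorem tensorNormSq_le (h : IsExtremalRemainder q b (b 0) D) :
    tensorNormSq b q ≤ (23 * (m + 1) ^ 4 * D) ^ 2 := by
  have hD := h.nonneg
  calc tensorNormSq b q
      ≤ ∑ _i : Fin (m + 1), ∑ _j : Fin (m + 1), ∑ _k : Fin (m + 1),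
          (23 * ((m + 1) ^ 2 * D)) ^ 2 :=
        Finset.sum_le_sum fun i _ => Finset.sum_le_sum fun j _ => Finset.sum_le_sum fun k _ =>
          sq_le_sq' (neg_le_of_abs_le (h.abs_le_of_basis i j k))
            (le_of_abs_le (h.abs_le_of_basis i j k))
    _ = (23 * D) ^ 2 * ((m : ℝ) + 1) ^ 7 := by simp; ring
    -- The exponent 7 is 4 from the squared entry bound and 3 from the number of entries; raising it
    -- to 8 makes the bound a perfect square.
    _ ≤ (23 * D) ^ 2 * ((m : ℝ) + 1) ^ 8 := by
        gcongr
        · simp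
        · norm_num
    _ = _ := by ring

end Bound

end IsExtremalRemainder

end Entries

/-! ### The best axis and the local inequality. -/

section Stability

variable {E : Type*} [NormedAddCommGroup E] [InnerProductSpace ℝ E]
variable {ι : Type*} [Fintype ι] {a : E → E → E → ℝ}

theorem continuous_axisFunctional (h : IsSymTrilinear a) (b : OrthonormalBasis ι ℝ E) :
    Continuous (axisFunctional b a) := by
  have : axisFunctional b a = fun f => 4 * (∑ i, ⟪f, b i⟫ * ∑ j, ⟪f, b j⟫ * ∑ k, ⟪f, b k⟫ *
      a (b i) (b j) (b k)) - 3 * ∑ i, ∑ j, ⟪f, b j⟫ * a (b j) (b i) (b i) := by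
    funext f
    simp only [sum_inner_mul_map (h.isLinearMap_right _ _),
      sum_inner_mul_map (h.isLinearMap_mid _ _), sum_inner_mul_map (h.isLinearMap_left _ _),
      axisFunctional]
  rw [this]
  fun_prop

theorem axisFunctional_eq (h : IsSymTrilinear a) (b c : OrthonormalBasis ι ℝ E) (f : E) :
    axisFunctional b a f = axisFunctional c a f := by
  rw [axisFunctional, axisFunctional, sum_bilinear_diag_eq (β := fun x y => a f x y)
    (fun y => h.isLinearMap_mid f y) (fun x => h.isLinearMap_right f x) b c]

/-- The derivative of `axisFunctional` along the great circle from `f` towards `u` vanishes at the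
maximizer. -/
theorem critical_axis (h : IsSymTrilinear a) (b : OrthonormalBasis ι ℝ E) {f u : E}
    (hf : ‖f‖ = 1) (hu : ‖u‖ = 1) (hfu : ⟪f, u⟫ = 0)
    (hmax : ∀ g, ‖g‖ = 1 → axisFunctional b a g ≤ axisFunctional b a f) :
    4 * a f f u = ∑ i, a u (b i) (b i) := by
  set A := ∑ i, a f (b i) (b i) with hA
  set B := ∑ i, a u (b i) (b i) with hB
  have hexp (θ : ℝ) : axisFunctional b a (Real.cos θ • f + Real.sin θ • u) =
      4 * (Real.cos θ ^ 3 * a f f f + 3 * Real.cos θ ^ 2 * Real.sin θ * a f f u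
        + 3 * Real.cos θ * Real.sin θ ^ 2 * a f u u + Real.sin θ ^ 3 * a u u u)
      - 3 * (Real.cos θ * A + Real.sin θ * B) := by
    rw [axisFunctional, h.diag_combination]
    simp only [h.add_left, h.smul_left, Finset.sum_add_distrib, ← Finset.mul_sum, hA, hB]
  have hder : HasDerivAt (fun θ => axisFunctional b a (Real.cos θ • f + Real.sin θ • u))
      (12 * a f f u - 3 * B) 0 := by
    simp only [hexp]
    have hc := Real.hasDerivAt_cos 0
    have hs := Real.hasDerivAt_sin 0
    have := (((((hc.pow 3).mul_const (a f f f)).add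
      ((((hc.pow 2).const_mul 3).mul hs).mul_const (a f f u))).add
      (((hc.const_mul 3).mul (hs.pow 2)).mul_const (a f u u))).add
      ((hs.pow 3).mul_const (a u u u))).const_mul 4 |>.sub
      (((hc.mul_const A).add (hs.mul_const B)).const_mul 3)
    refine this.congr_deriv ?_
    simp
    ring
  have hloc : IsLocalMax (fun θ => axisFunctional b a (Real.cos θ • f + Real.sin θ • u)) 0 := by
    refine Filter.Eventually.of_forall fun θ => ?_
    simp only [Real.cos_zero, Real.sin_zero, one_smul, zero_smul, add_zero]
    refine hmax _ ?_
    have : ‖Real.cos θ • f + Real.sin θ • u‖ ^ 2 = 1 := by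
      rw [norm_add_sq_real, norm_smul, norm_smul, hf, hu, real_inner_smul_left,
        real_inner_smul_right, hfu]
      simp
    exact (pow_eq_one_iff_of_nonneg (norm_nonneg _) two_ne_zero).1 this
  have := hloc.hasDerivAt_eq_zero hder
  linarith

theorem exists_orthonormalBasis_zero_eq {m : ℕ} (b : OrthonormalBasis (Fin (m + 1)) ℝ E) {f : E}
    (hf : ‖f‖ = 1) : ∃ c : OrthonormalBasis (Fin (m + 1)) ℝ E, c 0 = f := by
  have : FiniteDimensional ℝ E := b.toBasis.finiteDimensional_of_finite
  obtain ⟨c, hc⟩ := Orthonormal.exists_orthonormalBasis_extension_of_card_eq (𝕜 := ℝ)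
    (ι := Fin (m + 1)) (Module.finrank_eq_card_basis b.toBasis) (v := fun _ => f) (s := {0})
    ⟨fun _ => hf, fun i j hij => (hij (Subsingleton.elim _ _)).elim⟩
  exact ⟨c, hc 0 rfl⟩

theorem chebyshevTensor_diag (f x : E) :
    chebyshevTensor f x x x = 4 * ⟪f, x⟫ ^ 3 - 3 * ⟪f, x⟫ * ‖x‖ ^ 2 := by
  rw [chebyshevTensor, real_inner_self_eq_norm_sq]; ring

/-- The Chebyshev cubic equals 1 at `f` and at every point of the circle family, so there the
remainder is at most `M - s`. The choice of `s` gives orthogonality to the tensor, and maximality of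
the axis gives the condition on `u ⊥ f`, where the Chebyshev tensor contributes nothing. -/
theorem isExtremalRemainder_sub (h : IsSymTrilinear a) (b : OrthonormalBasis ι ℝ E) {f : E}
    (hf : ‖f‖ = 1) (hmax : ∀ g, ‖g‖ = 1 → axisFunctional b a g ≤ axisFunctional b a f)
    {M s : ℝ} (hM : ∀ x, ‖x‖ = 1 → a x x x ≤ M)
    (hs : s * (3 * Fintype.card ι - 2) = axisFunctional b a f) :
    IsExtremalRemainder (fun x y z => a x y z - s * chebyshevTensor f x y z) b f (M - s) where
  symm := h.sub_smul (isSymTrilinear_chebyshevTensor f) s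
  axis := by
    have h₁ := axisFunctional_chebyshevTensor b f hf
    rw [← h₁, axisFunctional, axisFunctional] at hs
    rw [Finset.sum_sub_distrib, ← Finset.mul_sum]
    linarith
  perp u hu := by
    rcases eq_or_ne u 0 with rfl | h0
    · have e₁ : a f f 0 = 0 := by simpa using h.smul_right 0 f f 0
      have e₂ (x : E) : a 0 x x = 0 := by simpa using h.smul_left 0 0 x x
      simp [e₁, e₂, chebyshevTensor]
    · have hn : ‖u‖ ≠ 0 := norm_ne_zero_iff.2 h0
      have := critical_axis h b (u := ‖u‖⁻¹ • u) hf (by rw [norm_smul]; simp [hn])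
        (by rw [real_inner_smul_right, hu, mul_zero]) hmax
      simp only [h.smul_left, h.smul_right, ← Finset.mul_sum] at this
      have h₁ : 4 * a f f u = ∑ i, a u (b i) (b i) := by
        field_simp at this
        exact this
      rw [Finset.sum_sub_distrib, ← Finset.mul_sum, sum_chebyshevTensor b f u hf, hu, mul_sub, h₁,
        chebyshevTensor, hu]
      ring
  le_axis := by
    have : chebyshevTensor f f f f = 1 := by
      rw [chebyshevTensor_diag, real_inner_self_eq_norm_sq, hf]; norm_num
    rw [this]
    linarith [hM f hf]
  le_circle u hu hfu y hy := by
    have hn : ‖y‖ ^ 2 = 1 := by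
      rw [hy, norm_add_sq_real, norm_smul, norm_smul, hf, hu, real_inner_smul_left,
        real_inner_smul_right, hfu, mul_one, mul_one, Real.norm_eq_abs, Real.norm_eq_abs, sq_abs,
        sq_abs, div_pow, Real.sq_sqrt (by norm_num)]
      norm_num
    have hi : ⟪f, y⟫ = -(1 / 2) := by
      rw [hy, inner_add_right, real_inner_smul_right, real_inner_smul_right, hfu,
        real_inner_self_eq_norm_sq, hf]
      norm_num
    have : chebyshevTensor f y y y = 1 := by
      rw [chebyshevTensor_diag, hi, hn]; norm_num
    rw [this]
    linarith [hM y ((pow_eq_one_iff_of_nonneg (norm_nonneg _) two_ne_zero).1 hn)]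

theorem tensorNormSq_nonneg (b : OrthonormalBasis ι ℝ E) (a : E → E → E → ℝ) :
    0 ≤ tensorNormSq b a :=
  Finset.sum_nonneg fun _ _ => Finset.sum_nonneg fun _ _ => Finset.sum_nonneg fun _ _ => sq_nonneg _

theorem le_mul_of_le_sq_of_le_sq {x y z : ℝ} (hx : 0 ≤ x) (hy : 0 ≤ y) (hz : 0 ≤ z)
    (hxy : x ≤ y ^ 2) (hxz : x ≤ z ^ 2) : x ≤ y * z := by
  refine (pow_le_pow_iff_left₀ hx (by positivity) two_ne_zero).1 ?_
  rw [mul_pow, sq x]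
  exact mul_le_mul hxy hxz hx (by positivity)

theorem tensorNormSq_le_of_close {m : ℕ} (h : IsSymTrilinear a)
    (b : OrthonormalBasis (Fin (m + 1)) ℝ E) {M : ℝ} (hM : ∀ x, ‖x‖ = 1 → a x x x ≤ M)
    {f₀ : E} (hf₀ : ‖f₀‖ = 1)
    (hclose : tensorNormSq b (fun x y z => a x y z - 1 * chebyshevTensor f₀ x y z) <
      (1 / (100 * (m + 1) ^ 4)) ^ 2) :
    tensorNormSq b a ≤ (3 * (m + 1) - 2) * M ^ 2 := by
  have : FiniteDimensional ℝ E := b.toBasis.finiteDimensional_of_finite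
  have : ProperSpace E := FiniteDimensional.proper ℝ E
  obtain ⟨f, hf, hmax⟩ := (isCompact_sphere (0 : E) 1).exists_isMaxOn ⟨f₀, by simpa using hf₀⟩
    (continuous_axisFunctional h b).continuousOn
  replace hf : ‖f‖ = 1 := by simpa using hf
  replace hmax : ∀ g, ‖g‖ = 1 → axisFunctional b a g ≤ axisFunctional b a f :=
    fun g hg => hmax (by simpa using hg)
  obtain ⟨c, rfl⟩ := exists_orthonormalBasis_zero_eq b hf
  simp only [axisFunctional_eq h b c] at hmax
  rw [tensorNormSq_eq (h.sub_smul (isSymTrilinear_chebyshevTensor f₀) 1) b c,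
    tensorNormSq_sub_chebyshevTensor h c f₀ hf₀] at hclose
  rw [tensorNormSq_eq h b c]
  have hm : (0 : ℝ) ≤ m := m.cast_nonneg
  set W : ℝ := 3 * (m + 1) - 2 with hW
  have hW1 : 1 ≤ W := by linarith
  set F := axisFunctional c a (c 0) with hF
  have hFW : F / W * W = F := div_mul_cancel₀ _ (by positivity)
  set s := F / W with hs
  set ε : ℝ := 1 / (100 * (m + 1) ^ 4) with hε
  have hε0 : 0 < ε := by positivity
  have hε1 : ε ≤ 1 / 100 := by
    rw [hε]
    gcongr
    have : (1 : ℝ) ≤ (m + 1) ^ 4 := one_le_pow₀ (by linarith)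
    linarith
  have hcard : (3 * (Fintype.card (Fin (m + 1)) : ℝ) - 2) = W := by simp [hW]
  have hR := isExtremalRemainder_sub h c hf hmax hM (s := s) (by rw [hcard, hFW])
  have hD := hR.nonneg
  have hQ := hR.tensorNormSq_le
  have hdecomp := tensorNormSq_sub_chebyshevTensor h c (c 0) hf s
  rw [hcard, ← hF, ← hFW] at hdecomp
  rw [hcard] at hclose
  have hF₀ := hmax f₀ hf₀
  have hpos : 0 ≤ tensorNormSq c a := tensorNormSq_nonneg _ _
  set Q := tensorNormSq c (fun x y z => a x y z - s * chebyshevTensor (c 0) x y z) with hQdef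
  have hQ0 : 0 ≤ Q := tensorNormSq_nonneg _ _
  have hεsq : ε ^ 2 ≤ 1 / 100 := (pow_le_pow_left₀ hε0.le hε1 2).trans (by norm_num)
  -- Closeness gives `2 F(f₀) > W - ε²` for the axis functional `F`, and the maximal axis does at
  -- least as well as `f₀`.
  have hs4 : 1 / 4 ≤ s := by
    rw [hs, le_div_iff₀ (by positivity)]
    linarith
  -- Projecting onto the best axis leaves a remainder no larger than the distance to the given
  -- Chebyshev tensor; the slack is `(s - 1)² W`.
  have hQε : Q ≤ ε ^ 2 := by
    have : 0 ≤ (s - 1) ^ 2 * W := by positivity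
    rw [← hFW] at hF₀
    linarith
  set D := M - s with hDdef
  -- The radius `ε` is chosen so that the dimensional constant cancels, leaving `23/100 < 1/4`.
  have hk : 23 * ((m : ℝ) + 1) ^ 4 * D * ε ≤ D / 4 := by
    have : 23 * ((m : ℝ) + 1) ^ 4 * D * ε = 23 / 100 * D := by
      rw [hε]; field_simp
    rw [this]
    linarith
  have hQD : Q ≤ D / 4 := by
    refine le_trans ?_ hk
    exact le_mul_of_le_sq_of_le_sq hQ0 (by positivity) hε0.le hQ hQε
  have hM' : M = s + D := by rw [hDdef]; ring
  have : tensorNormSq c a = s ^ 2 * W + Q := by rw [hdecomp]; ring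
  rw [this, hM']
  have h₁ : 1 / 4 * D ≤ s * D := mul_le_mul_of_nonneg_right hs4 hD
  have h₂ : 2 * (s * D) + D ^ 2 ≤ W * (2 * (s * D) + D ^ 2) :=
    le_mul_of_one_le_left (by positivity) hW1
  have h₃ : W * (s + D) ^ 2 = s ^ 2 * W + W * (2 * (s * D) + D ^ 2) := by ring
  have h₄ := sq_nonneg D
  rw [h₃]
  linarith

end Stability

/-! ### Transfer from tensors to polynomials. -/

section PolarForm

variable {n : ℕ}

/-- The symmetric trilinear form of a cubic form. -/
noncomputable def polarForm (p : MvPolynomial (Fin n) ℝ) (x y z : EuclideanSpace ℝ (Fin n)) : ℝ :=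
  ∑ i, ∑ j, ∑ k, tensorEntry p i j k * (x i * y j * z k)

theorem isSymTrilinear_polarForm (p : MvPolynomial (Fin n) ℝ) : IsSymTrilinear (polarForm p) where
  add_left x x' y z := by
    simp only [polarForm, ← Finset.sum_add_distrib, PiLp.add_apply]
    refine Finset.sum_congr rfl fun i _ => Finset.sum_congr rfl fun j _ =>
      Finset.sum_congr rfl fun k _ => by ring
  smul_left c x y z := by
    simp only [polarForm, Finset.mul_sum, PiLp.smul_apply, smul_eq_mul]
    refine Finset.sum_congr rfl fun i _ => Finset.sum_congr rfl fun j _ =>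
      Finset.sum_congr rfl fun k _ => by ring
  comm12 x y z := by
    rw [polarForm, polarForm, Finset.sum_comm]
    refine Finset.sum_congr rfl fun i _ => Finset.sum_congr rfl fun j _ =>
      Finset.sum_congr rfl fun k _ => by rw [tensorEntry_comm12]; ring
  comm23 x y z := by
    refine Finset.sum_congr rfl fun i _ => ?_
    rw [Finset.sum_comm]
    refine Finset.sum_congr rfl fun j _ =>
      Finset.sum_congr rfl fun k _ => by rw [tensorEntry_comm23]; ring

theorem polarForm_diag {p : MvPolynomial (Fin n) ℝ} (hp : p ∈ forms 3 n)
    (x : EuclideanSpace ℝ (Fin n)) :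
    polarForm p x x x = MvPolynomial.eval (fun i => x i) p :=
  sum_tensorEntry_mul hp _

theorem polarForm_basisFun (p : MvPolynomial (Fin n) ℝ) (i j k : Fin n) :
    polarForm p (EuclideanSpace.basisFun _ ℝ i) (EuclideanSpace.basisFun _ ℝ j)
      (EuclideanSpace.basisFun _ ℝ k) = tensorEntry p i j k := by
  simp only [polarForm, EuclideanSpace.basisFun_apply]
  rw [Finset.sum_eq_single i, Finset.sum_eq_single j, Finset.sum_eq_single k] <;> simp_all

theorem tensorNormSq_polarForm {p : MvPolynomial (Fin n) ℝ} (hp : p ∈ forms 3 n) :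
    tensorNormSq (EuclideanSpace.basisFun _ ℝ) (polarForm p) = bombieriNorm p ^ 2 := by
  simp only [tensorNormSq, polarForm_basisFun, sum_tensorEntry_sq hp]

theorem polarForm_sub (p q : MvPolynomial (Fin n) ℝ) (x y z : EuclideanSpace ℝ (Fin n)) :
    polarForm (p - q) x y z = polarForm p x y z - polarForm q x y z := by
  simp only [polarForm, tensorEntry_sub, sub_mul, Finset.sum_sub_distrib]

theorem eval_chebyshevCubic [NeZero n] (x : EuclideanSpace ℝ (Fin n)) :
    MvPolynomial.eval (fun i => x i) (chebyshevCubic n) = 4 * x 0 ^ 3 - 3 * x 0 * ‖x‖ ^ 2 := by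
  rw [EuclideanSpace.real_norm_sq_eq, ← Finset.add_sum_erase _ _ (Finset.mem_univ (0 : Fin n))]
  simp only [chebyshevCubic, map_sub, map_mul, map_pow, map_sum, MvPolynomial.eval_X, map_ofNat]
  ring

theorem polarForm_chebyshevCubic [NeZero n] (x y z : EuclideanSpace ℝ (Fin n)) :
    polarForm (chebyshevCubic n) x y z =
      chebyshevTensor (EuclideanSpace.basisFun (Fin n) ℝ 0) x y z := by
  refine (isSymTrilinear_polarForm _).eq_of_diag_eq (isSymTrilinear_chebyshevTensor _)
    (fun x => ?_) x y z
  rw [polarForm_diag (chebyshevCubic_mem n), eval_chebyshevCubic, chebyshevTensor_diag,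
    EuclideanSpace.basisFun_apply, EuclideanSpace.inner_single_left]
  simp

theorem bombieriNorm_chebyshevCubic_sq [NeZero n] :
    bombieriNorm (chebyshevCubic n) ^ 2 = 3 * n - 2 := by
  have h := isSymTrilinear_chebyshevTensor (EuclideanSpace.basisFun (Fin n) ℝ 0)
  have hp : polarForm (chebyshevCubic n) =
      chebyshevTensor (EuclideanSpace.basisFun (Fin n) ℝ 0) := by
    funext x y z; exact polarForm_chebyshevCubic x y z
  rw [← tensorNormSq_polarForm (chebyshevCubic_mem n), hp]
  have h₁ := sum_mul_chebyshevTensor h (EuclideanSpace.basisFun (Fin n) ℝ)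
    (EuclideanSpace.basisFun (Fin n) ℝ 0)
  rw [axisFunctional_chebyshevTensor _ _ (OrthonormalBasis.norm_eq_one _ _), Fintype.card_fin] at h₁
  simpa only [tensorNormSq, sq] using h₁

theorem abs_eval_le_uniformNorm [NeZero n] (p : MvPolynomial (Fin n) ℝ)
    {x : EuclideanSpace ℝ (Fin n)} (hx : ‖x‖ = 1) :
    |MvPolynomial.eval (fun i => x i) p| ≤ uniformNorm p :=
  (uniformNorm_isGreatest p).2 ⟨x, by simpa [unitSphere] using hx, rfl⟩

theorem uniformNorm_le [NeZero n] (p : MvPolynomial (Fin n) ℝ) {M : ℝ}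
    (h : ∀ x : EuclideanSpace ℝ (Fin n), ‖x‖ = 1 → |MvPolynomial.eval (fun i => x i) p| ≤ M) :
    uniformNorm p ≤ M := by
  obtain ⟨x, hx, hxe⟩ := (uniformNorm_isGreatest p).1
  rw [← hxe]
  exact h x (by simpa [unitSphere] using hx)

theorem uniformNorm_nonneg [NeZero n] (p : MvPolynomial (Fin n) ℝ) : 0 ≤ uniformNorm p := by
  obtain ⟨x, hx, hxe⟩ := (uniformNorm_isGreatest p).1
  rw [← hxe]
  exact abs_nonneg _

theorem uniformNorm_chebyshevCubic [NeZero n] : uniformNorm (chebyshevCubic n) = 1 := by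
  apply le_antisymm
  · refine uniformNorm_le _ fun x hx => ?_
    have h0 : |x 0| ≤ 1 := by
      have := PiLp.norm_apply_le x 0
      rwa [hx] at this
    rw [eval_chebyshevCubic, hx]
    obtain ⟨h1, h2⟩ := abs_le.1 h0
    rw [abs_le]
    constructor
    -- With `t = x 0`, the relevant factorizations are `1 - (4t³ - 3t) = (1 - t)(2t + 1)²` and `1 +
    -- (4t³ - 3t) = (1 + t)(2t - 1)²`.
    · nlinarith [mul_nonneg (sub_nonneg.2 h2) (sq_nonneg (2 * x 0 + 1)),
        mul_nonneg (neg_le_iff_add_nonneg.1 h1) (sq_nonneg (2 * x 0 - 1))]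
    · nlinarith [mul_nonneg (sub_nonneg.2 h2) (sq_nonneg (2 * x 0 + 1)),
        mul_nonneg (neg_le_iff_add_nonneg.1 h1) (sq_nonneg (2 * x 0 - 1))]
  · have h := abs_eval_le_uniformNorm (chebyshevCubic n) (x := EuclideanSpace.basisFun (Fin n) ℝ 0)
      (OrthonormalBasis.norm_eq_one _ _)
    rw [eval_chebyshevCubic, OrthonormalBasis.norm_eq_one] at h
    norm_num at h
    exact h

theorem bombieriNorm_nonneg (p : MvPolynomial (Fin n) ℝ) : 0 ≤ bombieriNorm p := Real.sqrt_nonneg _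

theorem bombieriNorm_pos {p : MvPolynomial (Fin n) ℝ} (h0 : p ≠ 0) : 0 < bombieriNorm p := by
  refine Real.sqrt_pos.2 (Finset.sum_pos (fun α hα => ?_) (MvPolynomial.support_nonempty.2 h0))
  have h₁ : 0 < (α.multinomial : ℝ) := (Nat.cast_nonneg _).lt_of_ne' (multinomial_ne_zero α)
  have h₂ : 0 < |p.coeff α| := abs_pos.2 (MvPolynomial.mem_support_iff.1 hα)
  positivity

theorem bombieriNorm_chebyshevCubic [NeZero n] :
    bombieriNorm (chebyshevCubic n) = √(3 * n - 2) := by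
  rw [← bombieriNorm_chebyshevCubic_sq, Real.sqrt_sq (bombieriNorm_nonneg _)]

theorem weight_pos [NeZero n] : (0 : ℝ) < 3 * n - 2 := by
  have : (1 : ℝ) ≤ n := by exact_mod_cast NeZero.one_le
  linarith

theorem normRatio_chebyshevCubic_le_iff [NeZero n] {p : MvPolynomial (Fin n) ℝ} (h0 : p ≠ 0) :
    normRatio (chebyshevCubic n) ≤ normRatio p ↔
      bombieriNorm p ^ 2 ≤ (3 * n - 2) * uniformNorm p ^ 2 := by
  have hu := uniformNorm_nonneg p
  rw [normRatio, normRatio, uniformNorm_chebyshevCubic, bombieriNorm_chebyshevCubic,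
    div_le_div_iff₀ (Real.sqrt_pos.2 weight_pos) (bombieriNorm_pos h0), one_mul,
    ← pow_le_pow_iff_left₀ (bombieriNorm_nonneg p) (by positivity) two_ne_zero, mul_pow,
    Real.sq_sqrt weight_pos.le, mul_comm]

theorem chebyshevCubic_isLocalMin [NeZero n] : ∃ ε : ℝ, 0 < ε ∧
    ∀ p ∈ forms 3 n, p ≠ 0 → bombieriNorm (p - chebyshevCubic n) < ε →
      normRatio (chebyshevCubic n) ≤ normRatio p := by
  obtain ⟨m, rfl⟩ := Nat.exists_eq_succ_of_ne_zero (NeZero.ne n)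
  refine ⟨1 / (100 * (m + 1) ^ 4), by positivity, fun p hp h0 hε => ?_⟩
  rw [normRatio_chebyshevCubic_le_iff h0, ← tensorNormSq_polarForm hp]
  have hsub : polarForm (p - chebyshevCubic (m + 1)) = fun x y z => polarForm p x y z -
      1 * chebyshevTensor (EuclideanSpace.basisFun (Fin (m + 1)) ℝ 0) x y z := by
    funext x y z
    rw [polarForm_sub, polarForm_chebyshevCubic, one_mul]
  have h := pow_lt_pow_left₀ hε (bombieriNorm_nonneg _) two_ne_zero
  rw [← tensorNormSq_polarForm (Submodule.sub_mem _ hp (chebyshevCubic_mem _)), hsub] at h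
  have hM (x : EuclideanSpace ℝ (Fin (m + 1))) (hx : ‖x‖ = 1) :
      polarForm p x x x ≤ uniformNorm p := by
    rw [polarForm_diag hp]
    exact le_of_abs_le (abs_eval_le_uniformNorm p hx)
  have := tensorNormSq_le_of_close (isSymTrilinear_polarForm p) _ hM
    (OrthonormalBasis.norm_eq_one _ _) h
  rwa [← Nat.cast_succ] at this

end PolarForm

open MvPolynomial

/-! ### The block cubic, which beats the Chebyshev form in high dimension. -/

section Blocks

variable {n m : ℕ}

theorem sum_le_bombieriNorm_sq {κ : Type*} [Fintype κ] {α : κ → Fin n →₀ ℕ}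
    (hα : Function.Injective α) (p : MvPolynomial (Fin n) ℝ) :
    ∑ k, ((α k).multinomial : ℝ)⁻¹ * |p.coeff (α k)| ^ 2 ≤ bombieriNorm p ^ 2 := by
  classical
  rw [bombieriNorm, Real.sq_sqrt (by positivity)]
  rw [← Finset.sum_image (f := fun β : Fin n →₀ ℕ => (β.multinomial : ℝ)⁻¹ * |p.coeff β| ^ 2)
    (g := α) (s := Finset.univ) hα.injOn, ← Finset.sum_filter_add_sum_filter_not _ (· ∈ p.support)]
  rw [Finset.sum_eq_zero (s := Finset.filter (fun β => ¬ β ∈ p.support) _), add_zero]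
  · exact Finset.sum_le_sum_of_subset_of_nonneg (fun β hβ => (Finset.mem_filter.1 hβ).2)
      fun _ _ _ => by positivity
  · intro β hβ
    rw [notMem_support_iff.1 (Finset.mem_filter.1 hβ).2]
    simp

/-- The `s`-th variable of the `j`-th pair of variables. -/
def pairIndex (h : 2 * (m + 1) ≤ n) (t : Fin (m + 1) × Fin 2) : Fin n := ⟨2 * t.1 + t.2, by omega⟩

theorem pairIndex_injective (h : 2 * (m + 1) ≤ n) : Function.Injective (pairIndex h) := by
  rintro ⟨i, s⟩ ⟨j, t⟩ hij
  simp only [pairIndex, Fin.mk.injEq] at hij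
  ext <;> simp <;> omega

/-- The monomials of `∑ⱼ Re((u + iv)(yⱼ + izⱼ)²)`. -/
def blockTriple (h : 2 * (m + 1) ≤ n) (t : Fin m × Fin 3) : Fin n × Fin n × Fin n :=
  let y := pairIndex h (t.1.succ, 0)
  let z := pairIndex h (t.1.succ, 1)
  ![(pairIndex h (0, 0), y, y), (pairIndex h (0, 0), z, z), (pairIndex h (0, 1), y, z)] t.2

/-- The cubic form `∑ⱼ Re((u + iv)(yⱼ + izⱼ)²)`. -/
noncomputable def blockCubic (h : 2 * (m + 1) ≤ n) : MvPolynomial (Fin n) ℝ :=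
  ∑ t : Fin m × Fin 3, monomial (tripleExponent (blockTriple h t)) (![1, -1, -2] t.2)

theorem blockCubic_mem (h : 2 * (m + 1) ≤ n) : blockCubic h ∈ forms 3 n := by
  refine Submodule.sum_mem _ fun t _ => ?_
  rw [mem_homogeneousSubmodule]
  refine isHomogeneous_monomial _ ?_
  simp [tripleExponent]

theorem tripleExponent_blockTriple_injective (h : 2 * (m + 1) ≤ n) :
    Function.Injective fun t => tripleExponent (blockTriple h t) := by
  rintro ⟨i, s⟩ ⟨j, t⟩ hij
  -- The exponent of `v` detects the mixed monomial; the exponents of `yᵢ` and `zᵢ` then determine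
  -- the block and which square occurs.
  have h₁ := DFunLike.congr_fun hij (pairIndex h (0, 1))
  have h₂ := DFunLike.congr_fun hij (pairIndex h (i.succ, 0))
  have h₃ := DFunLike.congr_fun hij (pairIndex h (i.succ, 1))
  fin_cases s <;> fin_cases t <;>
    simp [tripleExponent, blockTriple, Finsupp.single_apply, (pairIndex_injective h).eq_iff,
      Fin.succ_ne_zero, (Fin.succ_ne_zero _).symm] at h₁ h₂ h₃ ⊢ <;>
    grind

theorem coeff_blockCubic (h : 2 * (m + 1) ≤ n) (t : Fin m × Fin 3) :
    (blockCubic h).coeff (tripleExponent (blockTriple h t)) = ![1, -1, -2] t.2 := by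
  rw [blockCubic, coeff_sum]
  simp only [coeff_monomial]
  rw [Finset.sum_eq_single t, if_pos rfl]
  · intro t' _ ht
    rw [if_neg fun e => ht (tripleExponent_blockTriple_injective h e)]
  · simp

theorem multinomial_tripleExponent_le (t : Fin n × Fin n × Fin n) :
    (tripleExponent t).multinomial ≤ 6 := by
  have : (tripleExponent t).sum (fun _ => id) = 3 :=
    (Finset.mem_finsuppAntidiag'.1 (tripleExponent_mem t)).1
  rw [Finsupp.multinomial, this]
  exact Nat.div_le_self _ _

theorem multinomial_tripleExponent_pair {i j : Fin n} (hij : i ≠ j) :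
    (tripleExponent (i, j, j)).multinomial = 3 := by
  rw [Finsupp.multinomial_eq_of_support_subset (s := {i, j}), Nat.binomial_eq_choose hij]
  · simp [tripleExponent, hij, hij.symm]
  · intro k hk
    by_contra hk'
    simp only [Finset.mem_insert, Finset.mem_singleton, not_or] at hk'
    simp [tripleExponent, Ne.symm hk'.1, Ne.symm hk'.2] at hk

/-- Each block contributes at least `1/3 + 1/3 + 4/6 = 4/3`. -/
theorem le_bombieriNorm_blockCubic_sq (h : 2 * (m + 1) ≤ n) :
    4 / 3 * (m : ℝ) ≤ bombieriNorm (blockCubic h) ^ 2 := by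
  refine le_trans ?_ (sum_le_bombieriNorm_sq (tripleExponent_blockTriple_injective h) _)
  simp only [coeff_blockCubic, Fintype.sum_prod_type]
  calc 4 / 3 * (m : ℝ) = ∑ _j : Fin m, (4 / 3 : ℝ) := by simp; ring
    _ ≤ _ := Finset.sum_le_sum fun j _ => ?_
  have hne (s : Fin 2) : pairIndex h (0, 0) ≠ pairIndex h (j.succ, s) :=
    fun e => by simpa [Fin.ext_iff] using congrArg Prod.fst (pairIndex_injective h e)
  have h₁ : (tripleExponent (blockTriple h (j, 0))).multinomial = 3 :=
    multinomial_tripleExponent_pair (hne 0)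
  have h₂ : (tripleExponent (blockTriple h (j, 1))).multinomial = 3 :=
    multinomial_tripleExponent_pair (hne 1)
  have h₃ : (1 / 6 : ℝ) ≤ ((tripleExponent (blockTriple h (j, 2))).multinomial : ℝ)⁻¹ := by
    rw [one_div]
    refine inv_anti₀ ((Nat.cast_nonneg _).lt_of_ne' (multinomial_ne_zero _)) ?_
    exact_mod_cast multinomial_tripleExponent_le _
  rw [Fin.sum_univ_three, h₁, h₂]
  simp
  linarith

theorem eval_blockCubic (h : 2 * (m + 1) ≤ n) (x : Fin n → ℝ) :
    eval x (blockCubic h) = ∑ j : Fin m,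
      (x (pairIndex h (0, 0)) * (x (pairIndex h (j.succ, 0)) ^ 2 - x (pairIndex h (j.succ, 1)) ^ 2)
        - x (pairIndex h (0, 1)) *
          (2 * x (pairIndex h (j.succ, 0)) * x (pairIndex h (j.succ, 1)))) := by
  have hmon (t : Fin n × Fin n × Fin n) (c : ℝ) :
      eval x (monomial (tripleExponent t) c) = c * (x t.1 * x t.2.1 * x t.2.2) := by
    rw [eval_monomial, tripleExponent, Finsupp.prod_add_index', Finsupp.prod_add_index'] <;>
      simp [pow_add]
  simp only [blockCubic, map_sum, map_add, hmon, Fintype.sum_prod_type, Fin.sum_univ_three]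
  refine Finset.sum_congr rfl fun j _ => ?_
  simp [blockTriple]
  ring

/-- This is `|Re ζ| ≤ |ζ|` for `ζ = (u + iv)(y + iz)²`; the discarded square is that of the
imaginary part. -/
theorem abs_re_mul_sq_le (u v y z : ℝ) :
    |u * (y ^ 2 - z ^ 2) - v * (2 * y * z)| ≤ √(u ^ 2 + v ^ 2) * (y ^ 2 + z ^ 2) := by
  refine abs_le_of_sq_le_sq ?_ (by positivity)
  rw [mul_pow, Real.sq_sqrt (by positivity)]
  linarith [sq_nonneg (u * (2 * y * z) + v * (y ^ 2 - z ^ 2))]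

theorem eval_blockCubic_sq_le (h : 2 * (m + 1) ≤ n) (x : EuclideanSpace ℝ (Fin n))
    (hx : ‖x‖ = 1) : eval (fun i => x i) (blockCubic h) ^ 2 ≤ 4 / 27 := by
  have hsum : ∑ t, x (pairIndex h t) ^ 2 ≤ 1 := by
    have h1 : ∑ i, x i ^ 2 = 1 := by rw [← EuclideanSpace.real_norm_sq_eq, hx, one_pow]
    rw [← h1, ← Finset.sum_image (f := fun i => x i ^ 2) (pairIndex_injective h).injOn]
    exact Finset.sum_le_sum_of_subset_of_nonneg (Finset.subset_univ _) fun _ _ _ => sq_nonneg _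
  rw [Fintype.sum_prod_type, Fin.sum_univ_succ] at hsum
  simp only [Fin.sum_univ_two] at hsum
  set R := x (pairIndex h (0, 0)) ^ 2 + x (pairIndex h (0, 1)) ^ 2
  set S := ∑ j : Fin m, (x (pairIndex h (j.succ, 0)) ^ 2 + x (pairIndex h (j.succ, 1)) ^ 2)
  have hR : 0 ≤ R := by positivity
  have hS : 0 ≤ S := by positivity
  have hle : |eval (fun i => x i) (blockCubic h)| ≤ √R * S := by
    rw [eval_blockCubic, Finset.mul_sum]
    exact (Finset.abs_sum_le_sum_abs _ _).trans
      (Finset.sum_le_sum fun j _ => abs_re_mul_sq_le _ _ _ _)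
  calc _ = |eval (fun i => x i) (blockCubic h)| ^ 2 := (sq_abs _).symm
    _ ≤ (√R * S) ^ 2 := by gcongr
    _ = R * S ^ 2 := by rw [mul_pow, Real.sq_sqrt hR]
    _ ≤ (1 - S) * S ^ 2 := by gcongr; linarith
    -- The gap factors: `4/27 - (1 - S) S² = (S + 1/3)(S - 2/3)²`.
    _ ≤ 4 / 27 := by nlinarith [mul_nonneg (by positivity : 0 ≤ S + 1 / 3) (sq_nonneg (S - 2 / 3))]

theorem chebyshevCubic_not_globalMin [NeZero n] (hn : 8 ≤ n) :
    ∃ p ∈ forms 3 n, p ≠ 0 ∧ normRatio p < normRatio (chebyshevCubic n) := by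
  -- As many blocks as fit beside the pair `(u, v)`. With `n ≤ 2m + 3` the final comparison `(6m +
  -- 7) · 4/27 < 4m/3` amounts to `m > 7/3`, hence `m ≥ 3` and the threshold 8.
  obtain ⟨m, hm, h, hnm⟩ : ∃ m, 3 ≤ m ∧ 2 * (m + 1) ≤ n ∧ n ≤ 2 * m + 3 :=
    ⟨n / 2 - 1, by omega, by omega, by omega⟩
  have hB := le_bombieriNorm_blockCubic_sq h
  have hm' : (3 : ℝ) ≤ m := by exact_mod_cast hm
  have hn' : (n : ℝ) ≤ 2 * m + 3 := by exact_mod_cast hnm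
  have h0 : blockCubic h ≠ 0 := by
    intro e
    rw [e] at hB
    simp [bombieriNorm] at hB
    linarith
  refine ⟨blockCubic h, blockCubic_mem h, h0, ?_⟩
  rw [← not_le, normRatio_chebyshevCubic_le_iff h0, not_le]
  have hU : uniformNorm (blockCubic h) ^ 2 ≤ 4 / 27 := by
    obtain ⟨x, hx, hxe⟩ := (uniformNorm_isGreatest (blockCubic h)).1
    rw [← hxe]
    simpa only [sq_abs] using eval_blockCubic_sq_le h x (by simpa [unitSphere] using hx)
  calc (3 * (n : ℝ) - 2) * uniformNorm (blockCubic h) ^ 2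
      ≤ (3 * (n : ℝ) - 2) * (4 / 27) := mul_le_mul_of_nonneg_left hU weight_pos.le
    _ < _ := by linarith

end Blocks
end ChebyshevForm

/-- For every `n ≥ 2` the cubic Chebyshev form is a local minimum of the norm ratio on the nonzero
forms in `P_{3,n}` (neighborhoods in this finite-dimensional space are taken with respect to the
Bombieri norm), while for all sufficiently large `n` it is not a global minimum. -/
theorem mainTheorem7 :
    (∀ (n : ℕ) [NeZero n], 2 ≤ n →
      ∃ ε : ℝ, 0 < ε ∧
        ∀ p ∈ ChebyshevForm.forms 3 n, p ≠ 0 →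
          ChebyshevForm.bombieriNorm (p - ChebyshevForm.chebyshevCubic n) < ε →
            ChebyshevForm.normRatio (ChebyshevForm.chebyshevCubic n) ≤
              ChebyshevForm.normRatio p) ∧
    (∃ N : ℕ, ∀ (n : ℕ) [NeZero n], N ≤ n →
      ∃ p ∈ ChebyshevForm.forms 3 n, p ≠ 0 ∧
        ChebyshevForm.normRatio p <
          ChebyshevForm.normRatio (ChebyshevForm.chebyshevCubic n)) :=
  ⟨fun _ _ _ => ChebyshevForm.chebyshevCubic_isLocalMin,
    8, fun _ _ hn => ChebyshevForm.chebyshevCubic_not_globalMin hn⟩
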